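/- Let $\mathcal F$ be a signature (function symbols with fixed arities) and $\mathcal V$ an infinite set of variables. Let $\mathcal E$ be an equational system, i.e. a set of equations $s \approx t$ between terms over $\mathcal F$ and $\mathcal V$, and put $\mathcal E^{\pm} = \mathcal E \cup \{t \approx s \mid s \approx t \in \mathcal E\}$. Let $>$ be a ground-total reduction order, i.e. a well-founded strict partial order on terms that is closed under contexts and substitutions and is total on ground (variable-free) terms. Let $\mathcal E^{>}$ be the term rewrite system consisting of all rules $s\sigma \to t\sigma$ such that $s \approx t \in \mathcal E$, $\sigma$ is a substitution, and $s\sigma > t\sigma$. The set $\mathrm{ECP}_>(\mathcal E)$ of extended critical pairs consists of all equations $\ell_2[r_1]_p\mu \approx r_2\mu$ such that $\ell_1 \approx r_1$ and $\ell_2 \approx r_2$ are variable-disjoint variants (obtained by permuting variables) of equations in $\mathcal E^{\pm}$, $p$ is a position of $\ell_2$ at which a function symbol occurs, $\mu$ is a most general unifier of $\ell_1$ and $\ell_2|_p$, $r_1\mu \not> \ell_1\mu$, and $r_2\mu \not> \ell_2\mu$. Suppose that for every $s \approx t \in \mathcal E$ we have $s > t$ or $t \approx s \in \mathcal E$. Suppose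 further that for every $s \approx t \in \mathrm{ECP}_>(\mathcal E)$, either $s$ and $t$ have a common reduct under $\to^*_{\mathcal E^{>}}$, or there are an equation $s' \approx t' \in \mathcal E^{\pm}$ and a substitution $\sigma$ with $s = s'\sigma$ and $t = t'\sigma$. Then $\mathcal E^{>}$ is ground complete, that is, $\to_{\mathcal E^{>}}$ is terminating, and it is confluent on ground terms. -/

import Mathlib

universe u v w

namespace OrderedRewriting

open FirstOrder FirstOrder.Language

variable {L : FirstOrder.Language.{u, v}} {V : Type w}

/-- Terms over the function symbols of `L` and the variables `V` are `L.Term V`;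
a substitution is a map `V → L.Term V`, applied by `Term.subst`.
An equation or a rule is a pair of terms, and an equational system (ES) or a term rewrite
system (TRS) is a set of such pairs. -/
abbrev System (L : FirstOrder.Language.{u, v}) (V : Type w) := Set (L.Term V × L.Term V)

/-- A term is ground if no variable occurs in it. -/
def Ground [DecidableEq V] (t : L.Term V) : Prop := t.varFinset = ∅

/-- The term is a variable. -/
def IsVar (t : L.Term V) : Prop := ∃ x : V, t = Term.var x

/-- `subtermAt t p` is `t|_p`, and `none` if `p` is not a position of `t`.
Arguments are numbered from `0`. -/
def subtermAt : L.Term V → List ℕ → Option (L.Term V)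
  | t, [] => some t
  | Term.var _, _ :: _ => none
  | Term.func (l := n) _ ts, i :: p =>
      if h : i < n then subtermAt (ts ⟨i, h⟩) p else none

/-- `replaceAt t p s` is `t[s]_p` (and `t` itself if `p` is not a position of `t`). -/
def replaceAt : L.Term V → List ℕ → L.Term V → L.Term V
  | _, [], s => s
  | Term.var x, _ :: _, _ => Term.var x
  | Term.func (l := n) f ts, i :: p, s =>
      if h : i < n then
        Term.func f (Function.update ts ⟨i, h⟩ (replaceAt (ts ⟨i, h⟩) p s))
      else Term.func f ts

/-- One rewrite step `s →_R t`: for some rule `l → r` of `R`, some substitution `σ` and some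
position `p` of `s`, one has `s|_p = lσ` and `t = s[rσ]_p`. -/
def Step (R : System L V) (s t : L.Term V) : Prop :=
  ∃ l r : L.Term V, (l, r) ∈ R ∧ ∃ (σ : V → L.Term V) (p : List ℕ),
    subtermAt s p = some (l.subst σ) ∧ t = replaceAt s p (r.subst σ)

/-- `s →*_R t`. -/
def Steps (R : System L V) : L.Term V → L.Term V → Prop := Relation.ReflTransGen (Step R)

/-- `s ↓_R t`. -/
def Joinable (R : System L V) (s t : L.Term V) : Prop :=
  ∃ u : L.Term V, Steps R s u ∧ Steps R t u

/-- There is no infinite rewrite sequence (on arbitrary terms). -/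
def Terminating (R : System L V) : Prop := WellFounded (fun t s : L.Term V => Step R s t)

/-- Confluence on ground terms. -/
def GroundConfluent [DecidableEq V] (R : System L V) : Prop :=
  ∀ s t t' : L.Term V, Ground s → Steps R s t → Steps R s t' → Joinable R t t'

/-- A TRS is ground complete if it is terminating and confluent on ground terms. -/
def GroundComplete [DecidableEq V] (R : System L V) : Prop :=
  Terminating R ∧ GroundConfluent R

/-- A reduction order: a well-founded strict partial order on terms that is closed under
substitutions and contexts. `gt s t` reads `s > t`. -/
structure IsReductionOrder (gt : L.Term V → L.Term V → Prop) : Prop where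
  irrefl : ∀ s, ¬ gt s s
  trans : ∀ s t u, gt s t → gt t u → gt s u
  wf : WellFounded (fun t s => gt s t)
  subst : ∀ (s t : L.Term V) (σ : V → L.Term V), gt s t → gt (s.subst σ) (t.subst σ)
  context : ∀ {n : ℕ} (f : L.Functions n) (ts : Fin n → L.Term V) (i : Fin n) (s t : L.Term V),
    gt s t → gt (Term.func f (Function.update ts i s)) (Term.func f (Function.update ts i t))

/-- The order is total on ground terms. -/
def GroundTotal [DecidableEq V] (gt : L.Term V → L.Term V → Prop) : Prop :=
  ∀ s t : L.Term V, Ground s → Ground t → s = t ∨ gt s t ∨ gt t s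

/-- The symmetric closure `E^±`. -/
def symClosure (E : System L V) : System L V := E ∪ {e | (e.2, e.1) ∈ E}

/-- `E^>`: all rules `sσ → tσ` with `s ≈ t ∈ E` and `sσ > tσ`. -/
def ordered (E : System L V) (gt : L.Term V → L.Term V → Prop) : System L V :=
  {e | ∃ s t : L.Term V, (s, t) ∈ E ∧ ∃ σ : V → L.Term V,
    gt (s.subst σ) (t.subst σ) ∧ e = (s.subst σ, t.subst σ)}

/-- `(s, t)` is an instance of the equation `(s', t')`. -/
def IsInstance (s t s' t' : L.Term V) : Prop :=
  ∃ σ : V → L.Term V, s = s'.subst σ ∧ t = t'.subst σ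

/-- `(s, t)` is a variant of the equation `(s', t')`: it results from renaming the variables
by a permutation of `V`. -/
def IsVariant (s t s' t' : L.Term V) : Prop :=
  ∃ π : Equiv.Perm V, s = s'.relabel π ∧ t = t'.relabel π

/-- `(s, t)` and `(s', t')` have no variable in common. -/
def VarDisjoint [DecidableEq V] (s t s' t' : L.Term V) : Prop :=
  Disjoint (s.varFinset ∪ t.varFinset) (s'.varFinset ∪ t'.varFinset)

/-- `μ` is a most general unifier of `s` and `t`: a unifier through which every unifier
factors. -/
def IsMGU (μ : V → L.Term V) (s t : L.Term V) : Prop :=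
  s.subst μ = t.subst μ ∧
    ∀ σ : V → L.Term V, s.subst σ = t.subst σ → ∃ τ : V → L.Term V, ∀ x, σ x = (μ x).subst τ

/-- An extended overlap of `E`: variable-disjoint variants `l₁ ≈ r₁` and `l₂ ≈ r₂` of equations
in `E^±`, a function position `p` of `l₂`, and a most general unifier `μ` of `l₁` and `l₂|_p`. -/
def IsExtendedOverlap [DecidableEq V] (E : System L V) (l₁ r₁ l₂ r₂ : L.Term V) (p : List ℕ)
    (μ : V → L.Term V) : Prop :=
  (∃ s t, (s, t) ∈ symClosure E ∧ IsVariant l₁ r₁ s t) ∧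
  (∃ s t, (s, t) ∈ symClosure E ∧ IsVariant l₂ r₂ s t) ∧
  VarDisjoint l₁ r₁ l₂ r₂ ∧
  ∃ q : L.Term V, subtermAt l₂ p = some q ∧ ¬ IsVar q ∧ IsMGU μ l₁ q

/-- The set of extended critical pairs `l₂[r₁]_p μ ≈ r₂μ` of `E`, obtained from the extended
overlaps with neither `r₁μ > l₁μ` nor `r₂μ > l₂μ`. -/
def ECP [DecidableEq V] (gt : L.Term V → L.Term V → Prop) (E : System L V) : System L V :=
  {e | ∃ (l₁ r₁ l₂ r₂ : L.Term V) (p : List ℕ) (μ : V → L.Term V),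
    IsExtendedOverlap E l₁ r₁ l₂ r₂ p μ ∧
    ¬ gt (r₁.subst μ) (l₁.subst μ) ∧ ¬ gt (r₂.subst μ) (l₂.subst μ) ∧
    e = ((replaceAt l₂ p r₁).subst μ, r₂.subst μ)}

end OrderedRewriting

/-!
Every step of `ordered E gt` decreases in the order, which is well-founded: this is termination. By
Newman's lemma, applied to ground terms only, confluence reduces to joining a ground peak
`s ← u → t`. This restriction makes sense because a ground term dominates only ground terms:
if `s > t` with `s` ground and a variable in `t`, substituting `s` for the variables of `t` gives
`s > C[s]` for some context `C`, hence the infinite descent `s > C[s] > C[C[s]] > ...`.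

Steps at disjoint positions commute, so after stripping a common context one of the two steps, with
an equation `l₂ ≈ r₂` and a substitution `σ₂`, happens at the root (`joinable_of_root_peak`).
* If the other step takes place inside the substitute `σ₂ x` of a variable, rewriting the other
  copies of `σ₂ x` leads from the two ends of the peak to `l₂σ'` and `r₂σ'` for one substitution
  `σ'` (`subtermAt_subst_cases`).
* If it takes place at a function position of `l₂`, the equations, renamed apart, have a most
  general unifier there, and the peak is an instance of an extended critical pair (`exists_ECP`).
  The pair meets the two order conditions because the steps decrease: `r₁μ > l₁μ` would be
  inherited by the instance. If the pair is joinable, so is its instance; otherwise the ends of the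
  peak are again a ground instance of an equation.

In the remaining cases the two ends are ground instances of an equation of `symClosure E`, and
ground totality makes them equal or related by a single step (`joinable_of_mem_symClosure`).

The existence of most general unifiers (`exists_isMGU`) is proved by the usual unification
procedure on lists of equations.
-/

namespace OrderedRewriting

open FirstOrder FirstOrder.Language

variable {L : FirstOrder.Language.{u, v}} {V : Type w}

/-! ### Substitutions and variables -/

theorem subst_subst (t : L.Term V) (σ τ : V → L.Term V) :
    (t.subst σ).subst τ = t.subst fun x => (σ x).subst τ := by
  induction t with
  | var => rfl
  | func _ _ ih => simp [ih]

theorem subst_var (t : L.Term V) : t.subst Term.var = t := by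
  induction t with
  | var => rfl
  | func _ _ ih => simp [ih]

theorem subst_relabel (t : L.Term V) (π : V → V) (σ : V → L.Term V) :
    (t.relabel π).subst σ = t.subst fun x => σ (π x) := by
  induction t with
  | var => rfl
  | func _ _ ih => simp [ih]

theorem subst_congr [DecidableEq V] {t : L.Term V} {σ τ : V → L.Term V}
    (h : ∀ x ∈ t.varFinset, σ x = τ x) : t.subst σ = t.subst τ := by
  induction t with
  | var => exact h _ (by simp)
  | func f ts ih =>
    simp only [Term.subst, Term.func.injEq, heq_eq_eq, true_and]
    funext i
    exact ih i fun x hx => h x (by simpa using ⟨i, hx⟩)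

theorem mem_varFinset_subst [DecidableEq V] {t : L.Term V} {σ : V → L.Term V} {z : V} :
    z ∈ (t.subst σ).varFinset ↔ ∃ x ∈ t.varFinset, z ∈ (σ x).varFinset := by
  induction t with
  | var => simp
  | func f ts ih => simp [ih]; tauto

theorem varFinset_relabel [DecidableEq V] (t : L.Term V) (π : V → V) :
    (t.relabel π).varFinset = t.varFinset.image π := by
  induction t with
  | var => simp
  | func f ts ih => simp [ih, Finset.biUnion_image]

theorem ground_iff [DecidableEq V] {t : L.Term V} : Ground t ↔ ∀ x, x ∉ t.varFinset :=
  Finset.eq_empty_iff_forall_notMem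

theorem ground_func [DecidableEq V] {n : ℕ} {f : L.Functions n} {ts : Fin n → L.Term V} :
    Ground (Term.func f ts) ↔ ∀ i, Ground (ts i) := by
  simp only [ground_iff, Term.varFinset, Finset.mem_biUnion, Finset.mem_univ, true_and]
  push Not
  exact forall_comm

theorem ground_subst [DecidableEq V] {t : L.Term V} {σ : V → L.Term V} :
    Ground (t.subst σ) ↔ ∀ x ∈ t.varFinset, Ground (σ x) := by
  simp only [ground_iff, mem_varFinset_subst]
  push Not
  exact ⟨fun h x hx z => h z x hx, fun h z x hx => h x hx z⟩

theorem subst_of_ground [DecidableEq V] {t : L.Term V} (h : Ground t) (σ : V → L.Term V) :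
    t.subst σ = t := by
  conv_rhs => rw [← subst_var t]
  exact subst_congr fun x hx => absurd hx (ground_iff.1 h x)

/-- Finitely many variables can be renamed away from finitely many others. -/
theorem exists_perm_disjoint [DecidableEq V] [Infinite V] (A B : Finset V) :
    ∃ π : Equiv.Perm V, ∀ a ∈ A, π a ∉ B := by
  induction A using Finset.induction_on with
  | empty => exact ⟨1, by simp⟩
  | insert a A ha ih =>
    obtain ⟨π, hπ⟩ := ih
    obtain ⟨c, hc⟩ := Infinite.exists_notMem_finset (B ∪ A.image π)
    simp only [Finset.mem_union, Finset.mem_image, not_or, not_exists, not_and] at hc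
    refine ⟨π.trans (Equiv.swap (π a) c), ?_⟩
    intro b hb
    rcases Finset.mem_insert.1 hb with rfl | hb
    · simpa using hc.1
    · have hne : b ≠ a := fun h => ha (h ▸ hb)
      rw [Equiv.trans_apply, Equiv.swap_apply_of_ne_of_ne (fun h => hne (π.injective h)) (hc.2 b hb)]
      exact hπ b hb

/-! ### Positions -/

theorem subtermAt_subst {t q : L.Term V} {p : List ℕ} (h : subtermAt t p = some q)
    (σ : V → L.Term V) : subtermAt (t.subst σ) p = some (q.subst σ) := by
  induction p generalizing t with
  | nil => simp_all [subtermAt]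
  | cons i p ih =>
    cases t with
    | var => simp [subtermAt] at h
    | func f ts =>
      simp only [subtermAt, Term.subst] at h ⊢
      split_ifs at h ⊢ with hi
      exact ih h

theorem replaceAt_subst {t q : L.Term V} {p : List ℕ} (h : subtermAt t p = some q)
    (r : L.Term V) (σ : V → L.Term V) :
    (replaceAt t p r).subst σ = replaceAt (t.subst σ) p (r.subst σ) := by
  induction p generalizing t with
  | nil => simp [replaceAt]
  | cons i p ih =>
    cases t with
    | var => simp [subtermAt] at h
    | func f ts =>
      simp only [subtermAt, replaceAt, Term.subst] at h ⊢
      split_ifs at h ⊢ with hi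
      simp only [Term.subst, Term.func.injEq, heq_eq_eq, true_and]
      rw [← ih h]
      funext j
      rcases eq_or_ne j ⟨i, hi⟩ with rfl | hj <;> simp [*]

theorem ground_subtermAt [DecidableEq V] {t a : L.Term V} {p : List ℕ}
    (h : subtermAt t p = some a) (ht : Ground t) : Ground a := by
  induction p generalizing t with
  | nil => simp_all [subtermAt]
  | cons i p ih =>
    cases t with
    | var => simp [subtermAt] at h
    | func f ts =>
      simp only [subtermAt] at h
      split_ifs at h with hi
      exact ih h (ground_func.1 ht _)

theorem ground_replaceAt [DecidableEq V] {t b : L.Term V} (p : List ℕ)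
    (ht : Ground t) (hb : Ground b) : Ground (replaceAt t p b) := by
  induction p generalizing t with
  | nil => simpa [replaceAt]
  | cons i p ih =>
    cases t with
    | var => simpa [replaceAt] using ht
    | func f ts =>
      simp only [replaceAt]
      split_ifs with hi
      · rw [ground_func] at ht ⊢
        intro j
        rcases eq_or_ne j ⟨i, hi⟩ with rfl | hj
        · simpa using ih (ht _)
        · simpa [hj] using ht j
      · exact ht

/-! ### Rewriting -/

variable {R : System L V}

theorem step_func {n : ℕ} (f : L.Functions n) (ts : Fin n → L.Term V) (i : Fin n)
    {s t : L.Term V} (h : Step R s t) :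
    Step R (Term.func f (Function.update ts i s)) (Term.func f (Function.update ts i t)) := by
  obtain ⟨l, r, hlr, σ, p, hp, rfl⟩ := h
  exact ⟨l, r, hlr, σ, i :: p, by simpa [subtermAt] using hp, by simp [replaceAt]⟩

theorem steps_func_update {n : ℕ} (f : L.Functions n) (ts : Fin n → L.Term V) (i : Fin n)
    {s t : L.Term V} (h : Steps R s t) :
    Steps R (Term.func f (Function.update ts i s)) (Term.func f (Function.update ts i t)) :=
  Relation.ReflTransGen.lift (fun a => Term.func f (Function.update ts i a))
    (fun _ _ => step_func f ts i) _ _ h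

theorem steps_func {n : ℕ} (f : L.Functions n) {ts us : Fin n → L.Term V}
    (h : ∀ i, Steps R (ts i) (us i)) : Steps R (Term.func f ts) (Term.func f us) := by
  suffices H : ∀ S : Finset (Fin n),
      Steps R (Term.func f ts) (Term.func f (S.piecewise us ts)) by
    simpa using H Finset.univ
  intro S
  induction S using Finset.induction_on with
  | empty => exact Finset.piecewise_empty us ts ▸ Relation.ReflTransGen.refl
  | insert i S hi ih =>
    refine ih.trans ?_
    have := steps_func_update f (S.piecewise us ts) i (h i)
    rwa [Finset.piecewise_insert, ← Function.update_eq_self i (S.piecewise us ts),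
      Function.update_idem, Finset.piecewise_eq_of_notMem _ _ _ hi]

theorem steps_subst (t : L.Term V) {σ σ' : V → L.Term V}
    (h : ∀ x, Steps R (σ x) (σ' x)) : Steps R (t.subst σ) (t.subst σ') := by
  induction t with
  | var => exact h _
  | func f ts ih => exact steps_func f ih

theorem Joinable.symm {s t : L.Term V} (h : Joinable R s t) : Joinable R t s :=
  let ⟨u, hs, ht⟩ := h; ⟨u, ht, hs⟩

theorem Joinable.of_steps {s s' t t' : L.Term V} (hs : Steps R s s') (ht : Steps R t t')
    (h : Joinable R s' t') : Joinable R s t :=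
  let ⟨u, hs', ht'⟩ := h; ⟨u, hs.trans hs', ht.trans ht'⟩

theorem Joinable.func_update {n : ℕ} (f : L.Functions n) (ts : Fin n → L.Term V) (i : Fin n)
    {s t : L.Term V} (h : Joinable R s t) :
    Joinable R (Term.func f (Function.update ts i s)) (Term.func f (Function.update ts i t)) :=
  let ⟨_, hs, ht⟩ := h; ⟨_, steps_func_update f ts i hs, steps_func_update f ts i ht⟩

/-- A position of `tσ` either is a function position of `t` or lies inside the substitute of a
variable of `t`. In the second case, after a replacement there, rewriting the other copies of
that substitute turns the whole term into another instance of `t`. -/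
theorem subtermAt_subst_cases [DecidableEq V] {t a : L.Term V} {σ : V → L.Term V} {p : List ℕ}
    (h : subtermAt (t.subst σ) p = some a) :
    (∃ q, subtermAt t p = some q ∧ ¬ IsVar q ∧ q.subst σ = a) ∨
    ∃ x ∈ t.varFinset, ∃ p' : List ℕ, subtermAt (σ x) p' = some a ∧
      ∀ (R : System L V) (b : L.Term V) (σ' : V → L.Term V), (∀ y, Steps R (σ y) (σ' y)) →
        σ' x = replaceAt (σ x) p' b → Steps R (replaceAt (t.subst σ) p b) (t.subst σ') := by
  induction t generalizing p with
  | var x =>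
    refine Or.inr ⟨x, by simp, p, h, fun R b σ' _ hx => ?_⟩
    rw [Term.subst, Term.subst, hx]
    exact Relation.ReflTransGen.refl
  | func f ts ih =>
    cases p with
    | nil =>
      refine Or.inl ⟨Term.func f ts, rfl, ?_, by simpa [subtermAt] using h⟩
      rintro ⟨x, hx⟩
      cases hx
    | cons i p =>
      simp only [subtermAt, Term.subst] at h
      split_ifs at h with hi
      rcases ih ⟨i, hi⟩ h with ⟨q, hq, hv, rfl⟩ | ⟨x, hx, p', hp', H⟩
      · exact Or.inl ⟨q, by simpa [subtermAt, hi] using hq, hv, rfl⟩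
      · refine Or.inr ⟨x, by simpa using ⟨⟨i, hi⟩, hx⟩, p', hp', fun R b σ' hσ hxσ => ?_⟩
        simp only [Term.subst, replaceAt, hi, dite_true]
        refine steps_func f fun j => ?_
        rcases eq_or_ne j ⟨i, hi⟩ with rfl | hj
        · simpa using H R b σ' hσ hxσ
        · simpa [hj] using steps_subst (ts j) hσ

/-! ### Most general unifiers -/

/-- The number of symbol occurrences in a term. -/
def termSize : L.Term V → ℕ
  | Term.var _ => 1
  | Term.func _ ts => 1 + ∑ i, termSize (ts i)

theorem termSize_pos (t : L.Term V) : 0 < termSize t := by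
  cases t <;> simp [termSize]

theorem termSize_le_subst [DecidableEq V] {t : L.Term V} {x : V} (hx : x ∈ t.varFinset)
    (σ : V → L.Term V) : termSize (σ x) ≤ termSize (t.subst σ) := by
  induction t with
  | var y => simp_all
  | func f ts ih =>
    simp only [Term.varFinset, Finset.mem_biUnion, Finset.mem_univ, true_and] at hx
    obtain ⟨i, hi⟩ := hx
    have := Finset.single_le_sum (f := fun i => termSize ((ts i).subst σ)) (fun _ _ => Nat.zero_le _)
      (Finset.mem_univ i)
    have := ih i hi
    simp only [Term.subst, termSize]
    omega

/-- The occurs check: a variable cannot be unified with a proper superterm. -/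
theorem notMem_varFinset_of_unifier [DecidableEq V] {t : L.Term V} {x : V} {σ : V → L.Term V}
    (h : σ x = t.subst σ) (hne : t ≠ Term.var x) : x ∉ t.varFinset := by
  intro hx
  cases t with
  | var y => simp_all
  | func f ts =>
    simp only [Term.varFinset, Finset.mem_biUnion, Finset.mem_univ, true_and] at hx
    obtain ⟨i, hi⟩ := hx
    have h1 := Finset.single_le_sum (f := fun i => termSize ((ts i).subst σ))
      (fun _ _ => Nat.zero_le _) (Finset.mem_univ i)
    have h2 := termSize_le_subst hi σ
    have h3 := congrArg termSize h
    simp only [Term.subst, termSize] at h3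
    omega

/-- `σ` unifies both sides of every equation of the list. -/
def Unifies (σ : V → L.Term V) (S : List (L.Term V × L.Term V)) : Prop :=
  ∀ e ∈ S, e.1.subst σ = e.2.subst σ

/-- `μ` is an idempotent most general unifier of the list of equations: every unifier `σ` factors
through `μ`, with `σ` itself as the second factor. -/
def IsSolution (μ : V → L.Term V) (S : List (L.Term V × L.Term V)) : Prop :=
  Unifies μ S ∧ ∀ σ, Unifies σ S → ∀ x, (μ x).subst σ = σ x

theorem isSolution_congr {S T : List (L.Term V × L.Term V)}
    (h : ∀ σ, Unifies σ S ↔ Unifies σ T) {μ : V → L.Term V} :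
    IsSolution μ S ↔ IsSolution μ T := by
  simp only [IsSolution, h]

theorem subst_update_subst [DecidableEq V] {x : V} {t : L.Term V} {σ : V → L.Term V}
    (h : σ x = t.subst σ) (s : L.Term V) :
    (s.subst (Function.update Term.var x t)).subst σ = s.subst σ := by
  rw [subst_subst]
  congr 1
  funext y
  rcases eq_or_ne y x with rfl | hy <;> simp [*]

/-- The elimination step of unification: solving `x ≈ t` together with `S` reduces to solving
`S` with `x` replaced by `t`. -/
theorem isSolution_elim [DecidableEq V] {x : V} {t : L.Term V} (hx : x ∉ t.varFinset)
    {S : List (L.Term V × L.Term V)} {μ : V → L.Term V}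
    (hμ : IsSolution μ (S.map fun e => (e.1.subst (Function.update Term.var x t),
      e.2.subst (Function.update Term.var x t)))) :
    IsSolution (fun y => (Function.update Term.var x t y).subst μ) ((Term.var x, t) :: S) := by
  set ρ : V → L.Term V := Function.update Term.var x t with hρ
  have hρt : t.subst ρ = t := by
    conv_rhs => rw [← subst_var t]
    refine subst_congr fun y hy => ?_
    have : y ≠ x := fun h => hx (h ▸ hy)
    simp [hρ, this]
  refine ⟨?_, ?_⟩
  · intro e he
    rcases List.mem_cons.1 he with rfl | he
    · rw [← subst_subst, ← subst_subst, hρt]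
      simp [hρ]
    · rw [← subst_subst, ← subst_subst]
      exact hμ.1 _ (List.mem_map.2 ⟨e, he, rfl⟩)
  · intro σ hσ y
    have hxt : σ x = t.subst σ := hσ (Term.var x, t) (by simp)
    have hσ' : Unifies σ (S.map fun e => (e.1.subst ρ, e.2.subst ρ)) := by
      intro e he
      obtain ⟨e', he', rfl⟩ := List.mem_map.1 he
      simp only [hρ, subst_update_subst hxt]
      exact hσ e' (List.mem_cons_of_mem _ he')
    rw [subst_subst, funext (hμ.2 σ hσ')]
    exact subst_update_subst hxt (Term.var y)

/-- A list of equations that has a unifier has a most general one. The set `W` bounds the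
variables in play; elimination of a variable shrinks it, and decomposition of an equation between
compound terms shrinks the total size. -/
theorem exists_isSolution [DecidableEq V] (W : Finset V) (S : List (L.Term V × L.Term V))
    (hW : ∀ e ∈ S, e.1.varFinset ⊆ W ∧ e.2.varFinset ⊆ W) (θ : V → L.Term V)
    (hθ : Unifies θ S) : ∃ μ, IsSolution μ S := by
  induction W using Finset.strongInduction generalizing S with
  | H W ihW =>
  induction hn : (S.map fun e => termSize e.1 + termSize e.2).sum
    using Nat.strong_induction_on generalizing S with
  | _ n ihn =>
  cases S with
  | nil => exact ⟨Term.var, by simp [Unifies], fun σ _ x => rfl⟩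
  | cons e S =>
  obtain ⟨s, t⟩ := e
  have hWS : ∀ e ∈ S, e.1.varFinset ⊆ W ∧ e.2.varFinset ⊆ W :=
    fun e he => hW e (List.mem_cons_of_mem _ he)
  have hθS : Unifies θ S := fun e he => hθ e (List.mem_cons_of_mem _ he)
  obtain ⟨hsW, htW⟩ := hW (s, t) (by simp)
  have hst : s.subst θ = t.subst θ := hθ (s, t) (by simp)
  simp only [List.map_cons, List.sum_cons] at hn
  have elim : ∀ (x : V) (t : L.Term V), x ∈ W → t.varFinset ⊆ W → θ x = t.subst θ →
      ∃ μ, IsSolution μ ((Term.var x, t) :: S) := by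
    intro x t hxW htW hxt
    by_cases hne : t = Term.var x
    · obtain ⟨μ, hμ⟩ := ihn _ (by have := termSize_pos s; omega) S hWS hθS rfl
      refine ⟨μ, (isSolution_congr fun σ => ?_).1 hμ⟩
      simp [Unifies, hne]
    · have hx := notMem_varFinset_of_unifier hxt hne
      have hsub : ∀ u : L.Term V, u.varFinset ⊆ W →
          (u.subst (Function.update Term.var x t)).varFinset ⊆ W.erase x := by
        intro u hu z hz
        obtain ⟨y, hy, hz⟩ := mem_varFinset_subst.1 hz
        rcases eq_or_ne y x with rfl | hyx
        · simp only [Function.update_self] at hz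
          exact Finset.mem_erase.2 ⟨fun h => hx (h ▸ hz), htW hz⟩
        · simp only [Function.update_of_ne hyx, Term.varFinset, Finset.mem_singleton] at hz
          exact Finset.mem_erase.2 ⟨hz ▸ hyx, hz ▸ hu hy⟩
      obtain ⟨μ, hμ⟩ := ihW (W.erase x) (Finset.erase_ssubset hxW)
        (S.map fun e => (e.1.subst (Function.update Term.var x t),
          e.2.subst (Function.update Term.var x t)))
        (by
          intro e he
          obtain ⟨e', he', rfl⟩ := List.mem_map.1 he
          exact ⟨hsub _ (hWS e' he').1, hsub _ (hWS e' he').2⟩)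
        (by
          intro e he
          obtain ⟨e', he', rfl⟩ := List.mem_map.1 he
          simp only [subst_update_subst hxt]
          exact hθS e' he')
      exact ⟨_, isSolution_elim hx hμ⟩
  cases s with
  | var x => exact elim x t (hsW (by simp)) htW hst
  | func f ts =>
  cases t with
  | var x =>
    obtain ⟨μ, hμ⟩ := elim x (Term.func f ts) (htW (by simp)) hsW hst.symm
    refine ⟨μ, (isSolution_congr fun σ => ?_).1 hμ⟩
    simp only [Unifies, List.forall_mem_cons]
    exact and_congr_left' eq_comm
  | func g us =>
    simp only [Term.subst, Term.func.injEq] at hst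
    obtain ⟨rfl, hfg, hargs⟩ := hst
    obtain rfl := eq_of_heq hfg
    have hargs := congrFun (eq_of_heq hargs)
    set T : List (L.Term V × L.Term V) := (List.ofFn fun i => (ts i, us i)) ++ S with hT
    have hlt : (T.map fun e => termSize e.1 + termSize e.2).sum < n := by
      simp only [termSize] at hn
      simp only [hT, List.map_append, List.map_ofFn, List.sum_append, List.sum_ofFn,
        Function.comp_def, Finset.sum_add_distrib]
      omega
    have hWT : ∀ e ∈ T, e.1.varFinset ⊆ W ∧ e.2.varFinset ⊆ W := by
      simp only [hT, List.forall_mem_append, List.forall_mem_ofFn_iff]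
      refine ⟨fun i => ⟨?_, ?_⟩, hWS⟩
      · exact (Finset.subset_biUnion_of_mem (fun i => (ts i).varFinset)
          (Finset.mem_univ i)).trans hsW
      · exact (Finset.subset_biUnion_of_mem (fun i => (us i).varFinset)
          (Finset.mem_univ i)).trans htW
    have hθT : Unifies θ T := by
      simp only [hT, Unifies, List.forall_mem_append, List.forall_mem_ofFn_iff]
      exact ⟨hargs, hθS⟩
    obtain ⟨μ, hμ⟩ := ihn _ hlt T hWT hθT rfl
    refine ⟨μ, (isSolution_congr fun σ => ?_).1 hμ⟩
    simp only [hT, Unifies, List.forall_mem_cons, List.forall_mem_append,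
      List.forall_mem_ofFn_iff, Term.subst, Term.func.injEq, heq_eq_eq, true_and, funext_iff]

/-- Unifiable terms have a most general unifier. -/
theorem exists_isMGU [DecidableEq V] {s t : L.Term V} {θ : V → L.Term V}
    (h : s.subst θ = t.subst θ) : ∃ μ, IsMGU μ s t := by
  obtain ⟨μ, hμ⟩ := exists_isSolution (s.varFinset ∪ t.varFinset) [(s, t)]
    (by simp [Finset.subset_union_left, Finset.subset_union_right]) θ (by simpa [Unifies] using h)
  refine ⟨μ, by simpa [Unifies] using hμ.1, fun σ hσ => ⟨σ, fun x => ?_⟩⟩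
  exact (hμ.2 σ (by simpa [Unifies] using hσ) x).symm

/-! ### Reduction orders and ordered rewriting -/

variable {E : System L V} {gt : L.Term V → L.Term V → Prop}

/-- A term cannot dominate a term that contains it: otherwise `a > C[a] > C[C[a]] > ...`. -/
theorem IsReductionOrder.not_gt_context (hgt : IsReductionOrder gt) {C : L.Term V → L.Term V}
    (hC : ∀ a b, gt a b → gt (C a) (C b)) (a : L.Term V) : ¬ gt a (C a) := by
  induction a using hgt.wf.induction with
  | h a ih => exact fun h => ih (C a) h (hC _ _ h)

/-- A single occurrence of `x` in `t` exhibits `tσ` as a context, monotone for the order, around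
`σ x`. -/
theorem IsReductionOrder.exists_context [DecidableEq V] (hgt : IsReductionOrder gt)
    {t : L.Term V} {x : V} (hx : x ∈ t.varFinset) (σ : V → L.Term V) :
    ∃ C : L.Term V → L.Term V, (∀ a b, gt a b → gt (C a) (C b)) ∧ C (σ x) = t.subst σ := by
  induction t with
  | var y =>
    obtain rfl : x = y := by simpa using hx
    exact ⟨id, fun _ _ h => h, rfl⟩
  | func f ts ih =>
    simp only [Term.varFinset, Finset.mem_biUnion, Finset.mem_univ, true_and] at hx
    obtain ⟨i, hi⟩ := hx
    obtain ⟨C, hC, hCx⟩ := ih i hi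
    refine ⟨fun a => Term.func f (Function.update (fun j => (ts j).subst σ) i (C a)),
      fun a b h => hgt.context _ _ _ _ _ (hC a b h), ?_⟩
    simp [hCx]

/-- Ground terms dominate only ground terms. -/
theorem IsReductionOrder.ground_of_gt [DecidableEq V] (hgt : IsReductionOrder gt)
    {s t : L.Term V} (hs : Ground s) (h : gt s t) : Ground t := by
  refine ground_iff.2 fun x hx => ?_
  obtain ⟨C, hC, hCx⟩ := hgt.exists_context hx fun _ => s
  refine hgt.not_gt_context hC s ?_
  rw [hCx]
  simpa only [subst_of_ground hs] using hgt.subst s t (fun _ => s) h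

theorem IsReductionOrder.gt_replaceAt (hgt : IsReductionOrder gt) {t a b : L.Term V} {p : List ℕ}
    (hp : subtermAt t p = some a) (h : gt a b) : gt t (replaceAt t p b) := by
  induction p generalizing t with
  | nil => simp_all [subtermAt, replaceAt]
  | cons i p ih =>
    cases t with
    | var => simp [subtermAt] at hp
    | func f ts =>
      simp only [subtermAt, replaceAt] at hp ⊢
      split_ifs at hp ⊢ with hi
      simpa using hgt.context f ts ⟨i, hi⟩ _ _ (ih hp)

theorem gt_of_mem_ordered {a b : L.Term V} (h : (a, b) ∈ ordered E gt) : gt a b := by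
  obtain ⟨s, t, _, σ, hσ, he⟩ := h
  cases he
  exact hσ

theorem mem_ordered_subst (hgt : IsReductionOrder gt) {a b : L.Term V}
    (h : (a, b) ∈ ordered E gt) (τ : V → L.Term V) :
    (a.subst τ, b.subst τ) ∈ ordered E gt := by
  obtain ⟨s, t, hst, σ, hσ, he⟩ := h
  cases he
  refine ⟨s, t, hst, fun x => (σ x).subst τ, ?_, ?_⟩
  · simpa only [subst_subst] using hgt.subst _ _ τ hσ
  · simp only [subst_subst]

/-- Since `ordered E gt` is closed under substitutions, its rules need not be instantiated. -/
theorem step_ordered_iff (hgt : IsReductionOrder gt) {s t : L.Term V} :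
    Step (ordered E gt) s t ↔ ∃ a b p, (a, b) ∈ ordered E gt ∧
      subtermAt s p = some a ∧ t = replaceAt s p b := by
  constructor
  · rintro ⟨l, r, h, σ, p, hp, ht⟩
    exact ⟨_, _, p, mem_ordered_subst hgt h σ, hp, ht⟩
  · rintro ⟨a, b, p, h, hp, ht⟩
    exact ⟨a, b, h, Term.var, p, by rwa [subst_var], by rwa [subst_var]⟩

theorem gt_of_step (hgt : IsReductionOrder gt) {s t : L.Term V}
    (h : Step (ordered E gt) s t) : gt s t := by
  obtain ⟨a, b, p, hab, hp, rfl⟩ := (step_ordered_iff hgt).1 h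
  exact hgt.gt_replaceAt hp (gt_of_mem_ordered hab)

theorem step_subst (hgt : IsReductionOrder gt) {s t : L.Term V}
    (h : Step (ordered E gt) s t) (τ : V → L.Term V) :
    Step (ordered E gt) (s.subst τ) (t.subst τ) := by
  obtain ⟨a, b, p, hab, hp, rfl⟩ := (step_ordered_iff hgt).1 h
  exact (step_ordered_iff hgt).2 ⟨_, _, p, mem_ordered_subst hgt hab τ, subtermAt_subst hp τ,
    replaceAt_subst hp b τ⟩

theorem Joinable.subst (hgt : IsReductionOrder gt) {s t : L.Term V}
    (h : Joinable (ordered E gt) s t) (τ : V → L.Term V) :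
    Joinable (ordered E gt) (s.subst τ) (t.subst τ) := by
  obtain ⟨u, hs, ht⟩ := h
  exact ⟨u.subst τ, Relation.ReflTransGen.lift (fun a : L.Term V => a.subst τ)
      (fun _ _ h => step_subst hgt h τ) _ _ hs,
    Relation.ReflTransGen.lift (fun a : L.Term V => a.subst τ)
      (fun _ _ h => step_subst hgt h τ) _ _ ht⟩

theorem step_of_mem_ordered (hgt : IsReductionOrder gt) {a b : L.Term V}
    (h : (a, b) ∈ ordered E gt) : Step (ordered E gt) a b :=
  (step_ordered_iff hgt).2 ⟨a, b, [], h, by simp [subtermAt], by simp [replaceAt]⟩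

/-- Ground instances of equations are joinable, in at most one step. -/
theorem joinable_of_mem_symClosure [DecidableEq V] (hgt : IsReductionOrder gt)
    (htotal : GroundTotal gt)
    (hE : ∀ s t : L.Term V, (s, t) ∈ E → gt s t ∨ (t, s) ∈ E) {s t : L.Term V}
    (hst : (s, t) ∈ symClosure E) {σ : V → L.Term V} (hs : Ground (s.subst σ))
    (ht : Ground (t.subst σ)) : Joinable (ordered E gt) (s.subst σ) (t.subst σ) := by
  -- An equation and a substitution that decreases from left to right give a rule: if only the
  -- converse equation is in `E`, it is oriented by the order, and the decrease is impossible.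
  have key : ∀ s t : L.Term V, (s, t) ∈ symClosure E → gt (s.subst σ) (t.subst σ) →
      Joinable (ordered E gt) (s.subst σ) (t.subst σ) := by
    intro s t hst h
    have hmem : (s, t) ∈ E := by
      rcases hst with hst | hst
      · exact hst
      · rcases hE t s hst with h' | h'
        · exact absurd (hgt.trans _ _ _ h (hgt.subst t s σ h')) (hgt.irrefl _)
        · exact h'
    exact ⟨t.subst σ, .single (step_of_mem_ordered hgt ⟨s, t, hmem, σ, h, rfl⟩), .refl⟩
  rcases htotal _ _ hs ht with h | h | h
  · exact ⟨t.subst σ, by rw [h]; exact .refl, .refl⟩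
  · exact key s t hst h
  · exact (key t s (hst.elim Or.inr Or.inl) h).symm

/-! ### Ground peaks -/

/-- If instances of two equations, decreasing from left to right, overlap at a function position,
then the two reducts form an instance of an extended critical pair. -/
theorem exists_ECP [DecidableEq V] [Infinite V] (hgt : IsReductionOrder gt)
    {s₁ t₁ l₂ r₂ q : L.Term V} {σ₁ σ₂ : V → L.Term V} {p : List ℕ}
    (h₁ : (s₁, t₁) ∈ E) (hσ₁ : gt (s₁.subst σ₁) (t₁.subst σ₁))
    (h₂ : (l₂, r₂) ∈ E) (hσ₂ : gt (l₂.subst σ₂) (r₂.subst σ₂))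
    (hq : subtermAt l₂ p = some q) (hqv : ¬ IsVar q) (hqσ : q.subst σ₂ = s₁.subst σ₁) :
    ∃ (e : L.Term V × L.Term V) (τ : V → L.Term V), e ∈ ECP gt E ∧
      e.1.subst τ = replaceAt (l₂.subst σ₂) p (t₁.subst σ₁) ∧ e.2.subst τ = r₂.subst σ₂ := by
  obtain ⟨π, hπ⟩ := exists_perm_disjoint (s₁.varFinset ∪ t₁.varFinset)
    (l₂.varFinset ∪ r₂.varFinset)
  -- The variables of the second equation keep `σ₂`; the renamed ones get `σ₁`.
  set σ : V → L.Term V := fun x =>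
    if x ∈ l₂.varFinset ∪ r₂.varFinset then σ₂ x else σ₁ (π.symm x) with hσ
  have hren : ∀ u : L.Term V, u.varFinset ⊆ s₁.varFinset ∪ t₁.varFinset →
      (u.relabel π).subst σ = u.subst σ₁ := by
    intro u hu
    rw [subst_relabel]
    refine subst_congr fun x hx => ?_
    simp only [hσ, if_neg (hπ x (hu hx)), Equiv.symm_apply_apply]
  have hold : ∀ u : L.Term V, u.varFinset ⊆ l₂.varFinset ∪ r₂.varFinset →
      u.subst σ = u.subst σ₂ := by
    intro u hu
    refine subst_congr fun x hx => ?_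
    simp only [hσ, if_pos (hu hx)]
  have hl₁ := hren s₁ Finset.subset_union_left
  have hr₁ := hren t₁ Finset.subset_union_right
  have hl₂ := hold l₂ Finset.subset_union_left
  have hr₂ := hold r₂ Finset.subset_union_right
  have hqs : q.subst σ = q.subst σ₂ :=
    Option.some.inj (by rw [← subtermAt_subst hq, ← subtermAt_subst hq, hl₂])
  have huni : (s₁.relabel π).subst σ = q.subst σ := by rw [hl₁, hqs, hqσ]
  obtain ⟨μ, hμ⟩ := exists_isMGU huni
  obtain ⟨τ, hτ⟩ := hμ.2 σ huni
  have hμτ : ∀ u : L.Term V, (u.subst μ).subst τ = u.subst σ := by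
    intro u
    rw [subst_subst, ← funext hτ]
  refine ⟨((replaceAt l₂ p (t₁.relabel π)).subst μ, r₂.subst μ), τ,
    ⟨s₁.relabel π, t₁.relabel π, l₂, r₂, p, μ, ⟨⟨s₁, t₁, Or.inl h₁, π, rfl, rfl⟩,
      ⟨l₂, r₂, Or.inl h₂, 1, ?_, ?_⟩, ?_, q, hq, hqv, hμ⟩, ?_, ?_, rfl⟩, ?_, ?_⟩
  · exact (Term.relabel_id l₂).symm
  · exact (Term.relabel_id r₂).symm
  · rw [VarDisjoint, varFinset_relabel, varFinset_relabel, ← Finset.image_union,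
      Finset.disjoint_left]
    intro z hz
    obtain ⟨x, hx, rfl⟩ := Finset.mem_image.1 hz
    exact hπ x hx
  · intro h
    have := hgt.subst _ _ τ h
    rw [hμτ, hμτ, hl₁, hr₁] at this
    exact hgt.irrefl _ (hgt.trans _ _ _ hσ₁ this)
  · intro h
    have := hgt.subst _ _ τ h
    rw [hμτ, hμτ, hl₂, hr₂] at this
    exact hgt.irrefl _ (hgt.trans _ _ _ hσ₂ this)
  · rw [hμτ, replaceAt_subst hq, hl₂, hr₁]
  · rw [hμτ, hr₂]

/-- The assumption on extended critical pairs: each of them is joinable or an instance of an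
equation. -/
def ECPCondition [DecidableEq V] (E : System L V) (gt : L.Term V → L.Term V → Prop) : Prop :=
  ∀ s t : L.Term V, (s, t) ∈ ECP gt E → Joinable (ordered E gt) s t ∨
    ∃ s' t' : L.Term V, (s', t') ∈ symClosure E ∧ IsInstance s t s' t'

/-- Ground peaks with one of the two steps at the root are joinable. -/
theorem joinable_of_root_peak [DecidableEq V] [Infinite V] (hgt : IsReductionOrder gt)
    (htotal : GroundTotal gt) (hE : ∀ s t : L.Term V, (s, t) ∈ E → gt s t ∨ (t, s) ∈ E)
    (hECP : ECPCondition E gt) {u b₁ a₁ b₂ : L.Term V} {p : List ℕ} (hu : Ground u)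
    (h₁ : (a₁, b₁) ∈ ordered E gt) (hp : subtermAt u p = some a₁)
    (h₂ : (u, b₂) ∈ ordered E gt) : Joinable (ordered E gt) (replaceAt u p b₁) b₂ := by
  have ha₁ : Ground a₁ := ground_subtermAt hp hu
  have hb₁ : Ground b₁ := hgt.ground_of_gt ha₁ (gt_of_mem_ordered h₁)
  have hb₂ : Ground b₂ := hgt.ground_of_gt hu (gt_of_mem_ordered h₂)
  have hpeak : Ground (replaceAt u p b₁) := ground_replaceAt p hu hb₁
  have hrule := h₁
  obtain ⟨s₁, t₁, hst₁, σ₁, hσ₁, he₁⟩ := h₁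
  obtain ⟨l₂, r₂, hlr₂, σ₂, hσ₂, he₂⟩ := h₂
  cases he₁
  cases he₂
  rcases subtermAt_subst_cases hp with ⟨q, hq, hqv, hqσ⟩ | ⟨x, hx, p', hp', H⟩
  · obtain ⟨⟨c, d⟩, τ, he, hc, hd⟩ := exists_ECP hgt hst₁ hσ₁ hlr₂ hσ₂ hq hqv hqσ
    dsimp only at hc hd
    rw [← hc] at hpeak ⊢
    rw [← hd] at hb₂ ⊢
    rcases hECP c d he with h | ⟨s', t', hst', σ', rfl, rfl⟩
    · exact h.subst hgt τ
    · rw [subst_subst] at hpeak hb₂ ⊢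
      rw [subst_subst]
      exact joinable_of_mem_symClosure hgt htotal hE hst' hpeak hb₂
  · set v := replaceAt (σ₂ x) p' (t₁.subst σ₁) with hv
    have hstep : Step (ordered E gt) (σ₂ x) v :=
      (step_ordered_iff hgt).2 ⟨_, _, p', hrule, hp', rfl⟩
    have hσ' : ∀ y, Steps (ordered E gt) (σ₂ y) (Function.update σ₂ x v y) := by
      intro y
      rcases eq_or_ne y x with rfl | hy
      · rw [Function.update_self]
        exact Relation.ReflTransGen.single hstep
      · rw [Function.update_of_ne hy]
        exact Relation.ReflTransGen.refl
    have hground : ∀ w : L.Term V, Ground (w.subst σ₂) →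
        Ground (w.subst (Function.update σ₂ x v)) := by
      intro w hw
      rw [ground_subst] at hw ⊢
      intro y hy
      rcases eq_or_ne y x with rfl | hyx
      · simpa using hgt.ground_of_gt (hw y hy) (gt_of_step hgt hstep)
      · simpa [hyx] using hw y hy
    exact Joinable.of_steps (H _ _ _ hσ' (by simp [hv])) (steps_subst r₂ hσ')
      (joinable_of_mem_symClosure hgt htotal hE (Or.inl hlr₂) (hground _ hu) (hground _ hb₂))

/-- Local confluence on ground terms. -/
theorem joinable_of_peak [DecidableEq V] [Infinite V] (hgt : IsReductionOrder gt)
    (htotal : GroundTotal gt) (hE : ∀ s t : L.Term V, (s, t) ∈ E → gt s t ∨ (t, s) ∈ E)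
    (hECP : ECPCondition E gt) {a₁ b₁ a₂ b₂ : L.Term V}
    (h₁ : (a₁, b₁) ∈ ordered E gt) (h₂ : (a₂, b₂) ∈ ordered E gt) {u : L.Term V}
    (hu : Ground u) {p₁ p₂ : List ℕ} (hp₁ : subtermAt u p₁ = some a₁)
    (hp₂ : subtermAt u p₂ = some a₂) :
    Joinable (ordered E gt) (replaceAt u p₁ b₁) (replaceAt u p₂ b₂) := by
  induction p₁ generalizing u p₂ with
  | nil =>
    obtain rfl : u = a₁ := by simpa [subtermAt] using hp₁
    simpa only [replaceAt] using (joinable_of_root_peak hgt htotal hE hECP hu h₂ hp₂ h₁).symm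
  | cons i p₁ ih =>
    cases p₂ with
    | nil =>
      obtain rfl : u = a₂ := by simpa [subtermAt] using hp₂
      simpa only [replaceAt] using joinable_of_root_peak hgt htotal hE hECP hu h₁ hp₁ h₂
    | cons j p₂ =>
      cases u with
      | var => simp [subtermAt] at hp₁
      | func f ts =>
        simp only [subtermAt, replaceAt] at hp₁ hp₂ ⊢
        split_ifs at hp₁ hp₂ ⊢ with hi hj
        rcases eq_or_ne i j with rfl | hij
        · exact (ih (ground_func.1 hu _) hp₁ hp₂).func_update f ts ⟨i, hi⟩
        · -- Steps in different arguments commute.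
          have hne : (⟨i, hi⟩ : Fin _) ≠ ⟨j, hj⟩ := by simpa using hij
          have s₁ : Step (ordered E gt) (ts ⟨i, hi⟩) (replaceAt (ts ⟨i, hi⟩) p₁ b₁) :=
            (step_ordered_iff hgt).2 ⟨_, _, p₁, h₁, hp₁, rfl⟩
          have s₂ : Step (ordered E gt) (ts ⟨j, hj⟩) (replaceAt (ts ⟨j, hj⟩) p₂ b₂) :=
            (step_ordered_iff hgt).2 ⟨_, _, p₂, h₂, hp₂, rfl⟩
          refine ⟨Term.func f (Function.update (Function.update ts ⟨i, hi⟩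
            (replaceAt (ts ⟨i, hi⟩) p₁ b₁)) ⟨j, hj⟩ (replaceAt (ts ⟨j, hj⟩) p₂ b₂)), ?_, ?_⟩
          · refine .single ?_
            have := step_func f (Function.update ts ⟨i, hi⟩ (replaceAt (ts ⟨i, hi⟩) p₁ b₁))
              ⟨j, hj⟩ s₂
            rwa [Function.update_comm hne, Function.update_eq_self] at this
          · refine .single ?_
            rw [Function.update_comm hne]
            have := step_func f (Function.update ts ⟨j, hj⟩ (replaceAt (ts ⟨j, hj⟩) p₂ b₂))
              ⟨i, hi⟩ s₁
            rwa [Function.update_comm hne.symm, Function.update_eq_self] at this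

/-- Newman's lemma, with the induction along the order and restricted to ground terms. -/
theorem groundConfluent_of_local [DecidableEq V] (hgt : IsReductionOrder gt)
    (hlocal : ∀ u s t : L.Term V, Ground u → Step (ordered E gt) u s → Step (ordered E gt) u t →
      Joinable (ordered E gt) s t) : GroundConfluent (ordered E gt) := by
  intro u
  induction u using hgt.wf.induction with
  | h u ih =>
    intro t t' hu ht ht'
    rcases ht.cases_head with rfl | ⟨s, hus, hst⟩
    · exact ⟨t', ht', .refl⟩
    rcases ht'.cases_head with rfl | ⟨s', hus', hst'⟩
    · exact ⟨t, .refl, ht⟩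
    have hs := gt_of_step hgt hus
    have hs' := gt_of_step hgt hus'
    obtain ⟨w, hsw, hsw'⟩ := hlocal u s s' hu hus hus'
    obtain ⟨x, htx, hwx⟩ := ih s hs t w (hgt.ground_of_gt hu hs) hst hsw
    obtain ⟨y, hxy, hty⟩ := ih s' hs' x t' (hgt.ground_of_gt hu hs') (hsw'.trans hwx) hst'
    exact ⟨y, htx.trans hxy, hty⟩

end OrderedRewriting

theorem lemma3 {L : FirstOrder.Language.{u, v}} {V : Type w} [DecidableEq V] [Infinite V]
    (E : OrderedRewriting.System L V) (gt : L.Term V → L.Term V → Prop)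
    (hgt : OrderedRewriting.IsReductionOrder gt)
    (htotal : OrderedRewriting.GroundTotal gt)
    (hE : ∀ s t : L.Term V, (s, t) ∈ E → gt s t ∨ (t, s) ∈ E)
    (hECP : ∀ s t : L.Term V, (s, t) ∈ OrderedRewriting.ECP gt E →
      OrderedRewriting.Joinable (OrderedRewriting.ordered E gt) s t ∨
        ∃ s' t' : L.Term V, (s', t') ∈ OrderedRewriting.symClosure E ∧
          OrderedRewriting.IsInstance s t s' t') :
    OrderedRewriting.GroundComplete (OrderedRewriting.ordered E gt) := by
  refine ⟨Subrelation.wf (fun h => OrderedRewriting.gt_of_step hgt h) hgt.wf,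
    OrderedRewriting.groundConfluent_of_local hgt fun u s t hu hs ht => ?_⟩
  obtain ⟨a₁, b₁, p₁, h₁, hp₁, rfl⟩ := (OrderedRewriting.step_ordered_iff hgt).1 hs
  obtain ⟨a₂, b₂, p₂, h₂, hp₂, rfl⟩ := (OrderedRewriting.step_ordered_iff hgt).1 ht
  exact OrderedRewriting.joinable_of_peak hgt htotal hE hECP h₁ h₂ hu hp₁ hp₂
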